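/- Let $n \ge 2$ and let $F \in \mathbb{R}^{3n\times 3n}$, with $3\times 3$ blocks $F_{ij}$ ($1\le i,j\le n$), be an $n$-view fundamental matrix: $F$ is symmetric, $F_{ii}=0$ for all $i$, and $\operatorname{rank}(F_{ij})=2$ for all $i\neq j$. For $\mathbf{t}\in\mathbb{R}^3$ let $[\mathbf{t}]_\times$ denote the matrix of $\mathbf{x}\mapsto \mathbf{t}\times\mathbf{x}$. Camera matrices $P_1,\dots,P_n\in\mathbb{R}^{3\times 4}$ are said to realize $F$ if there are invertible $V_i\in\mathbb{R}^{3\times 3}$ and vectors $\mathbf{t}_i\in\mathbb{R}^3$ such that $P_i=V_i^{-T}[I,\mathbf{t}_i]$ for all $i$ and $F_{ij}=V_i([\mathbf{t}_i]_\times-[\mathbf{t}_j]_\times)V_j^T$ for all $i,j$; $F$ is called consistent if some cameras realize it. The center of a camera $P_i$ is the point $\mathbf{c}_i\in\mathbb{R}^3$ with $P_i\binom{\mathbf{c}_i}{1}=0$. Then $F$ is consistent and can be realized by cameras with collinear centers if and only if the following two conditions hold: 1. $\operatorname{rank}(F)=4$, and $F$ has exactly 2 positive and 2 negative eigenvalues,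 counted with multiplicity; 2. $\operatorname{rank}(F_i)=2$ for every $i\in\{1,\dots,n\}$, where $F_i=[F_{i1},\dots,F_{in}]$ denotes the $i$-th $3\times 3n$ block-row of $F$. -/

import Mathlib

open Matrix

/-- The `3 × 3` block `F_{ij}` of a `3n × 3n` matrix, whose rows and columns are indexed by
pairs (view, coordinate). -/
def blockAt {n : ℕ} (F : Matrix (Fin n × Fin 3) (Fin n × Fin 3) ℝ) (i j : Fin n) :
    Matrix (Fin 3) (Fin 3) ℝ :=
  F.submatrix (fun a => (i, a)) (fun b => (j, b))

/-- The `i`-th block-row `F_i` of a `3n × 3n` matrix, of size `3 × 3n`. -/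
def blockRow {n : ℕ} (F : Matrix (Fin n × Fin 3) (Fin n × Fin 3) ℝ) (i : Fin n) :
    Matrix (Fin 3) (Fin n × Fin 3) ℝ :=
  F.submatrix (fun a => (i, a)) id

/-- `n`-view fundamental matrices: symmetric, with zero diagonal blocks and off-diagonal blocks
of rank two. -/
structure IsNViewFundamental {n : ℕ} (F : Matrix (Fin n × Fin 3) (Fin n × Fin 3) ℝ) : Prop where
  symm : F.IsSymm
  diag : ∀ i, blockAt F i i = 0
  rank_offDiag : ∀ i j, i ≠ j → (blockAt F i j).rank = 2

/-- The matrix `[t]_×` of the map `x ↦ t × x`. -/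
def crossMatrix (t : Fin 3 → ℝ) : Matrix (Fin 3) (Fin 3) ℝ :=
  !![0, -t 2, t 1;
     t 2, 0, -t 0;
     -t 1, t 0, 0]

theorem crossMatrix_mulVec (t x : Fin 3 → ℝ) :
    crossMatrix t *ᵥ x = crossProduct t x := by
  ext i
  fin_cases i <;>
    simp [crossMatrix, Matrix.mulVec, dotProduct, Fin.sum_univ_three, cross_apply] <;> ring

/-- The `3 × 4` camera matrix `V^{-T} [I, t]`. -/
noncomputable def cameraMatrix (V : Matrix (Fin 3) (Fin 3) ℝ) (t : Fin 3 → ℝ) :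
    Matrix (Fin 3) (Fin 3 ⊕ Fin 1) ℝ :=
  V⁻¹ᵀ * Matrix.fromCols (1 : Matrix (Fin 3) (Fin 3) ℝ) (Matrix.replicateCol (Fin 1) t)

/-- `c` is a center of the camera `P`: the homogeneous vector `(c, 1)` lies in the kernel
of `P`. -/
def IsCameraCenter (P : Matrix (Fin 3) (Fin 3 ⊕ Fin 1) ℝ) (c : Fin 3 → ℝ) : Prop :=
  P *ᵥ Sum.elim c (fun _ => 1) = 0

/-- The cameras `P_1, …, P_n` realize `F`: `P_i = V_i^{-T} [I, t_i]` with `V_i` invertible, and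
`F_{ij} = V_i ([t_i]_× - [t_j]_×) V_j^T` for all `i, j`. -/
def IsRealizedBy {n : ℕ} (F : Matrix (Fin n × Fin 3) (Fin n × Fin 3) ℝ)
    (P : Fin n → Matrix (Fin 3) (Fin 3 ⊕ Fin 1) ℝ) : Prop :=
  ∃ (V : Fin n → Matrix (Fin 3) (Fin 3) ℝ) (t : Fin n → Fin 3 → ℝ),
    (∀ i, IsUnit (V i).det) ∧
    (∀ i, P i = cameraMatrix (V i) (t i)) ∧
    ∀ i j, blockAt F i j = V i * (crossMatrix (t i) - crossMatrix (t j)) * (V j)ᵀ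

/-- `F` is consistent: some cameras realize it. -/
def IsConsistent {n : ℕ} (F : Matrix (Fin n × Fin 3) (Fin n × Fin 3) ℝ) : Prop :=
  ∃ P : Fin n → Matrix (Fin 3) (Fin 3 ⊕ Fin 1) ℝ, IsRealizedBy F P

/-- The cameras have centers, and these lie on a common line. -/
def HaveCollinearCenters {n : ℕ} (P : Fin n → Matrix (Fin 3) (Fin 3 ⊕ Fin 1) ℝ) : Prop :=
  ∃ c : Fin n → Fin 3 → ℝ, (∀ i, IsCameraCenter (P i) (c i)) ∧ Collinear ℝ (Set.range c)

/-- The number of positive (real) eigenvalues, counted with algebraic multiplicity. -/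
noncomputable def numPosEigenvalues {n : ℕ} (F : Matrix (Fin n × Fin 3) (Fin n × Fin 3) ℝ) : ℕ :=
  F.charpoly.roots.countP (fun x => 0 < x)

/-- The number of negative (real) eigenvalues, counted with algebraic multiplicity. -/
noncomputable def numNegEigenvalues {n : ℕ} (F : Matrix (Fin n × Fin 3) (Fin n × Fin 3) ℝ) : ℕ :=
  F.charpoly.roots.countP (fun x => x < 0)

/-!
Both conditions are compared with a normal form: `F_ij = (s_i - s_j) V_i [e₃]_× V_jᵀ` with invertible
`V_i` (`IsAxisForm`). Since the center of `V⁻ᵀ[I, t]` is `-t` and every cross product matrix is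
congruent to a multiple of `[e₃]_×`, this normal form exists exactly if `F` is realized by cameras
with collinear centers (`exists_realization_collinear_iff`).

Given the normal form, let `p` and `q` be the stacked first and second columns of the `V_i`, and
`sp`, `sq` the same columns with block `i` scaled by `s_i`. Then
`xᵀFx = 2 (sq·x)(p·x) - 2 (sp·x)(q·x)` is a difference of two products of linear forms. It is
negative semidefinite on one subspace of codimension at most two and positive semidefinite on
another, so that `F` has at most two positive and at most two negative eigenvalues; an invertible
`4 × 4` minor of a matrix congruent to `F` shows that the rank is four, so both counts are exactly
two (`IsAxisForm.rank_and_signature`). The third row of `V_i⁻¹` annihilates the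
`i`-th block-row.

Conversely, if every block-row has rank two, a block-diagonal congruence makes the third row and
column of each block vanish and leaves invertible `2 × 2` blocks `g_ij`, with `g_ii = 0`. For two
views `a ≠ b` the `4 × 4` minor formed by `g_ab` and `g_ba` is invertible, so rank four forces the
Schur complement formula `g_ij = X_i Y_jᵀ + Y_i X_jᵀ`, where `X_i = g_ia g_ba⁻¹` and `Y_i = g_ib`. Now
`g_ii = 0` says that `X_i Y_iᵀ` is skew. With `J` the standard skew `2 × 2` matrix, it follows that
`X_i = x_i C_i` and `Y_i = y_i C_i J` for some invertible `C_i`, hence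
`g_ij = (y_i x_j - x_i y_j) C_i J C_jᵀ`. After a projective change of the coordinate `(x_i : y_i)` that
makes all `x_i` nonzero, the ratios `s_i = y_i / x_i` give the normal form (`exists_planar_form`,
`exists_isAxisForm_of_rank`). The signature is not needed in this direction: a nondegenerate form in
four variables with two complementary isotropic planes has signature `(2, 2)`.
-/

/-! ### Eigenvalue counts of symmetric matrices -/

/-- One half of Sylvester's law of inertia: if `σ · xᵀAx ≤ 0` on the common kernel of `k` linear
forms, then at most `k` eigenvalues of `A` have the sign of `σ`. Otherwise some nonzero combination
of the eigenvectors for these eigenvalues would lie in that kernel. -/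
theorem card_eigenvalues_le_of_nonpos_on_ker {ι : Type*} [Fintype ι] [DecidableEq ι]
    {A : Matrix ι ι ℝ} (hA : A.IsHermitian) {k : ℕ} (L : (ι → ℝ) →ₗ[ℝ] (Fin k → ℝ)) (σ : ℝ)
    (h : ∀ x, L x = 0 → σ * (x ⬝ᵥ A *ᵥ x) ≤ 0) :
    Fintype.card {i // 0 < σ * hA.eigenvalues i} ≤ k := by
  by_contra hlt
  push Not at hlt
  set W : Matrix ι {i // 0 < σ * hA.eigenvalues i} ℝ :=
    (hA.eigenvectorUnitary : Matrix ι ι ℝ).submatrix id Subtype.val with hW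
  have hdiag : Wᵀ * A * W = diagonal fun i => hA.eigenvalues i.1 := by
    have h1 := hA.conjStarAlgAut_star_eigenvectorUnitary
    rw [Unitary.conjStarAlgAut_star_apply] at h1
    ext i j
    have h2 := congrFun (congrFun h1 i.1) j.1
    have h3 : (Wᵀ * A * W) i j =
        ((star hA.eigenvectorUnitary : Matrix ι ι ℝ) * A *
          (hA.eigenvectorUnitary : Matrix ι ι ℝ)) i.1 j.1 := by
      simp [hW, Matrix.mul_apply, Matrix.star_apply]
    rw [h3]
    refine h2.trans ?_
    by_cases hij : i = j
    · simp [hij]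
    · have : i.1 ≠ j.1 := fun e => hij (Subtype.ext e)
      simp [hij, this]
  obtain ⟨y, hy, hy0⟩ := Submodule.exists_mem_ne_zero_of_ne_bot
    (LinearMap.ker_ne_bot_of_finrank_lt (f := L ∘ₗ W.mulVecLin) (by simpa using hlt))
  have hle := h (W *ᵥ y) (by simpa using hy)
  have hq : W *ᵥ y ⬝ᵥ A *ᵥ (W *ᵥ y) = ∑ i, hA.eigenvalues i.1 * y i ^ 2 := by
    have : W *ᵥ y ⬝ᵥ A *ᵥ (W *ᵥ y) = y ⬝ᵥ (Wᵀ * A * W) *ᵥ y := by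
      rw [← mulVec_mulVec, ← mulVec_mulVec, dotProduct_mulVec y Wᵀ, vecMul_transpose]
    rw [this, hdiag]
    simp only [dotProduct, mulVec_diagonal]
    exact Finset.sum_congr rfl fun i _ => by ring
  rw [hq, Finset.mul_sum] at hle
  obtain ⟨i, hi⟩ := Function.ne_iff.mp hy0
  refine absurd hle (not_le.mpr (Finset.sum_pos' (fun j _ => ?_) ⟨i, Finset.mem_univ _, ?_⟩))
  · rw [← mul_assoc]; exact mul_nonneg j.2.le (sq_nonneg _)
  · rw [← mul_assoc]; exact mul_pos i.2 (pow_pos (abs_pos.mpr hi) 2 |>.trans_eq (sq_abs _))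

/-- Counting roots of the characteristic polynomial of a symmetric matrix amounts to counting
eigenvalue indices. -/
theorem countP_roots_charpoly_eq_card {ι : Type*} [Fintype ι] [DecidableEq ι]
    {A : Matrix ι ι ℝ} (hA : A.IsHermitian) (p : ℝ → Prop) [DecidablePred p] :
    A.charpoly.roots.countP p = Fintype.card {i // p (hA.eigenvalues i)} := by
  rw [hA.roots_charpoly_eq_eigenvalues, Multiset.countP_map, Fintype.card_subtype]
  rfl

theorem IsHermitian.rank_eq_card_pos_add_card_neg {ι : Type*} [Fintype ι] [DecidableEq ι]
    {A : Matrix ι ι ℝ} (hA : A.IsHermitian) :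
    A.rank = Fintype.card {i // 0 < hA.eigenvalues i} +
      Fintype.card {i // hA.eigenvalues i < 0} := by
  rw [hA.rank_eq_card_non_zero_eigs, Fintype.card_subtype, Fintype.card_subtype,
    Fintype.card_subtype, ← Finset.card_union_of_disjoint]
  · congr 1
    ext i
    simp [lt_or_lt_iff_ne, eq_comm]
  · exact Finset.disjoint_filter.mpr fun i _ h1 h2 => lt_asymm h1 h2

/-! ### Rank and kernels -/

theorem exists_vecMul_eq_zero_of_rank_lt {m n : Type*} [Fintype m] [Fintype n]
    (M : Matrix m n ℝ) (h : M.rank < Fintype.card m) : ∃ v, v ≠ 0 ∧ v ᵥ* M = 0 := by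
  have hk : LinearMap.ker Mᵀ.mulVecLin ≠ ⊥ := fun hb => by
    have := LinearMap.finrank_range_add_finrank_ker Mᵀ.mulVecLin
    rw [hb, finrank_bot, Module.finrank_fintype_fun_eq_card] at this
    have h2 : Mᵀ.rank = M.rank := rank_transpose M
    unfold Matrix.rank at h2 h
    omega
  obtain ⟨v, hv, hv0⟩ := Submodule.exists_mem_ne_zero_of_ne_bot hk
  exact ⟨v, hv0, by simpa [mulVec_transpose] using hv⟩

theorem rank_lt_of_vecMul_eq_zero {m n : Type*} [Fintype m] [Fintype n]
    (M : Matrix m n ℝ) {v : m → ℝ} (hv : v ≠ 0) (h : v ᵥ* M = 0) : M.rank < Fintype.card m := by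
  have hk : LinearMap.ker Mᵀ.mulVecLin ≠ ⊥ :=
    Submodule.ne_bot_iff _ |>.mpr ⟨v, by simpa [mulVec_transpose] using h, hv⟩
  have hpos : 0 < Module.finrank ℝ (LinearMap.ker Mᵀ.mulVecLin) :=
    Module.finrank_pos_iff.mpr (Submodule.nontrivial_iff_ne_bot.mpr hk)
  have := LinearMap.finrank_range_add_finrank_ker Mᵀ.mulVecLin
  rw [Module.finrank_fintype_fun_eq_card] at this
  have h2 : Mᵀ.rank = M.rank := rank_transpose M
  unfold Matrix.rank at h2 ⊢
  omega

/-- If the rank of `M` does not exceed the size of an invertible minor, then every entry of `M` is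
given by the Schur complement formula, since all bordered minors vanish. -/
theorem apply_eq_of_rank_le {m n k : Type*} [Fintype m] [Fintype n] [Fintype k] [DecidableEq k]
    (M : Matrix m n ℝ) (r : k → m) (c : k → n) (hrank : M.rank ≤ Fintype.card k)
    (hdet : IsUnit (M.submatrix r c).det) (i : m) (j : n) :
    M i j = (fun a => M i (c a)) ⬝ᵥ (M.submatrix r c)⁻¹ *ᵥ (fun a => M (r a) j) := by
  set A := M.submatrix r c with hA
  have : Invertible A := A.invertibleOfIsUnitDet hdet
  set B := M.submatrix (Sum.elim r fun _ : Unit => i) (Sum.elim c fun _ : Unit => j) with hB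
  have hB0 : B.det = 0 := by
    by_contra h0
    have h1 := rank_of_det_ne_zero (A := B) h0
    have h2 := rank_submatrix_le M (Sum.elim r fun _ : Unit => i) (Sum.elim c fun _ : Unit => j)
    rw [← hB, h1] at h2
    simp at h2
    omega
  have hBb : B = fromBlocks A (of fun a _ => M (r a) j) (of fun _ b => M i (c b))
      (of fun _ _ => M i j) := by
    ext (a | a) (b | b) <;> simp [hB, hA]
  rw [hBb, det_fromBlocks₁₁] at hB0
  rcases mul_eq_zero.mp hB0 with h0 | h0
  · exact absurd h0 hdet.ne_zero
  · rw [det_unique, Matrix.sub_apply, sub_eq_zero] at h0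
    rw [dotProduct_mulVec]
    simpa [Matrix.mul_apply, dotProduct, vecMul] using h0

/-! ### Block-diagonal congruence -/

/-- The block-diagonal `3n × 3n` matrix with diagonal blocks `N_1, …, N_n`, indexed like `F`. -/
def viewDiagonal {n : ℕ} (N : Fin n → Matrix (Fin 3) (Fin 3) ℝ) :
    Matrix (Fin n × Fin 3) (Fin n × Fin 3) ℝ :=
  of fun x y => if x.1 = y.1 then N x.1 x.2 y.2 else 0

theorem blockAt_viewDiagonal_conj {n : ℕ} (N : Fin n → Matrix (Fin 3) (Fin 3) ℝ)
    (F : Matrix (Fin n × Fin 3) (Fin n × Fin 3) ℝ) (i j : Fin n) :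
    blockAt (viewDiagonal N * F * (viewDiagonal N)ᵀ) i j = N i * blockAt F i j * (N j)ᵀ := by
  ext a b
  simp only [blockAt, submatrix_apply, Matrix.mul_apply, viewDiagonal, of_apply, transpose_apply,
    Fintype.sum_prod_type, ite_mul, mul_ite, zero_mul, mul_zero]
  rw [Finset.sum_eq_single j]
  · refine Finset.sum_congr rfl fun c _ => ?_
    rw [if_pos rfl, Finset.sum_eq_single i]
    · simp
    · intro k _ hk
      simp [hk.symm]
    · simp
  · intro k _ hk
    simp [hk.symm]
  · simp

theorem rank_viewDiagonal_conj_le {n : ℕ} (N : Fin n → Matrix (Fin 3) (Fin 3) ℝ)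
    (F : Matrix (Fin n × Fin 3) (Fin n × Fin 3) ℝ) :
    (viewDiagonal N * F * (viewDiagonal N)ᵀ).rank ≤ F.rank :=
  (rank_mul_le_left _ _).trans (rank_mul_le_right _ _)

theorem blockAt_transpose {n : ℕ} {F : Matrix (Fin n × Fin 3) (Fin n × Fin 3) ℝ}
    (h : F.IsSymm) (i j : Fin n) : (blockAt F i j)ᵀ = blockAt F j i := by
  ext a b
  exact h.apply _ _

/-! ### Normal form for collinear cameras -/

/-- The cross product matrix of the third basis vector. -/
def crossE3 : Matrix (Fin 3) (Fin 3) ℝ := !![0, -1, 0; 1, 0, 0; 0, 0, 0]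

/-- The normal form of an `n`-view fundamental matrix with collinear centers, in coordinates where
the line of centers is the third axis; center `i` lies at parameter `-s i`. -/
structure IsAxisForm {n : ℕ} (F : Matrix (Fin n × Fin 3) (Fin n × Fin 3) ℝ)
    (V : Fin n → Matrix (Fin 3) (Fin 3) ℝ) (s : Fin n → ℝ) : Prop where
  isUnit_det : ∀ i, IsUnit (V i).det
  block_eq : ∀ i j, blockAt F i j = (s i - s j) • (V i * crossE3 * (V j)ᵀ)

/-- Every cross product matrix is congruent to a multiple of that of the third basis vector. -/
theorem exists_crossMatrix_eq_congr (v : Fin 3 → ℝ) :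
    ∃ (Q : Matrix (Fin 3) (Fin 3) ℝ) (κ : ℝ), IsUnit Q.det ∧
      crossMatrix v = κ • (Q * crossE3 * Qᵀ) := by
  -- In each case the first two columns of `Q` are orthogonal to `v`, and so their cross product
  -- is a multiple of `v`.
  by_cases h2 : v 2 = 0
  · by_cases h1 : v 1 = 0
    · by_cases h0 : v 0 = 0
      · refine ⟨1, 0, by simp, ?_⟩
        ext i j
        fin_cases i <;> fin_cases j <;> simp [crossMatrix, h0, h1, h2]
      · refine ⟨!![-v 1, -v 2, 1; v 0, 0, 0; 0, v 0, 0], (v 0)⁻¹, ?_, ?_⟩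
        · simp [det_fin_three, h0]
        · ext i j
          fin_cases i <;> fin_cases j <;>
            simp [crossMatrix, crossE3, vecMul, dotProduct, Fin.sum_univ_three, h0, h1, h2]
    · refine ⟨!![v 1, 0, 0; -v 0, -v 2, 1; 0, v 1, 0], -(v 1)⁻¹, ?_, ?_⟩
      · simp [det_fin_three, h1]
      · ext i j
        fin_cases i <;> fin_cases j <;>
          simp [crossMatrix, crossE3, vecMul, dotProduct, Fin.sum_univ_three, h1, h2]
        field_simp
  · refine ⟨!![v 2, 0, 0; 0, v 2, 0; -v 0, -v 1, 1], (v 2)⁻¹, ?_, ?_⟩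
    · simp [det_fin_three, h2]
    · ext i j
      fin_cases i <;> fin_cases j <;>
        simp [crossMatrix, crossE3, vecMul, dotProduct, Fin.sum_univ_three, h2]
      all_goals field_simp
      all_goals ring

theorem isCameraCenter_cameraMatrix_iff {V : Matrix (Fin 3) (Fin 3) ℝ} (hV : IsUnit V.det)
    (t c : Fin 3 → ℝ) : IsCameraCenter (cameraMatrix V t) c ↔ c = -t := by
  have hcol : (fromCols (1 : Matrix (Fin 3) (Fin 3) ℝ) (replicateCol (Fin 1) t)) *ᵥ
      Sum.elim c (fun _ => 1) = c + t := by
    rw [fromCols_mulVec]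
    ext i
    simp [mulVec, dotProduct, replicateCol]
  rw [IsCameraCenter, cameraMatrix, ← mulVec_mulVec, hcol, ← add_eq_zero_iff_eq_neg]
  have hU : IsUnit (V⁻¹)ᵀ := by
    rw [isUnit_iff_isUnit_det, det_transpose, isUnit_nonsing_inv_det_iff]
    exact hV
  constructor
  · intro h
    exact mulVec_injective_of_isUnit hU (by simpa using h)
  · intro h
    rw [h, mulVec_zero]

/-- The normal form exists exactly if some cameras with collinear centers realize `F`. -/
theorem exists_realization_collinear_iff {n : ℕ} (F : Matrix (Fin n × Fin 3) (Fin n × Fin 3) ℝ) :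
    (∃ P : Fin n → Matrix (Fin 3) (Fin 3 ⊕ Fin 1) ℝ, IsRealizedBy F P ∧ HaveCollinearCenters P) ↔
      ∃ V s, IsAxisForm F V s := by
  constructor
  · rintro ⟨P, ⟨V, t, hV, hP, hblock⟩, c, hc, hcol⟩
    obtain ⟨p, v, hpv⟩ := (collinear_iff_exists_forall_eq_smul_vadd _).mp hcol
    choose r hr using fun i => hpv (c i) ⟨i, rfl⟩
    obtain ⟨Q, κ, hQ, hv⟩ := exists_crossMatrix_eq_congr v
    have ht : ∀ i, t i = -(r i • v + p) := fun i => by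
      have h1 := hc i
      rw [hP i, isCameraCenter_cameraMatrix_iff (hV i)] at h1
      have h2 := hr i
      rw [vadd_eq_add] at h2
      rw [← h2, h1, neg_neg]
    refine ⟨fun i => V i * Q, fun i => -(κ * r i), fun i => ?_, fun i j => ?_⟩
    · rw [det_mul]
      exact (hV i).mul hQ
    · have hd : crossMatrix (t i) - crossMatrix (t j) =
          (-(κ * r i) - -(κ * r j)) • (Q * crossE3 * Qᵀ) := by
        have h1 : crossMatrix (t i) - crossMatrix (t j) = (r j - r i) • crossMatrix v := by
          rw [ht i, ht j]
          ext a b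
          fin_cases a <;> fin_cases b <;> simp [crossMatrix] <;> ring
        rw [h1, hv, smul_smul]
        congr 1
        ring
      rw [hblock, hd, transpose_mul]
      simp only [Matrix.mul_smul, Matrix.smul_mul, Matrix.mul_assoc]
  · rintro ⟨V, s, hV, hblock⟩
    refine ⟨fun i => cameraMatrix (V i) (s i • ![0, 0, 1]), ⟨V, fun i => s i • ![0, 0, 1], hV,
      fun _ => rfl, fun i j => ?_⟩, fun i => -(s i • ![0, 0, 1]), fun i => ?_, ?_⟩
    · have h1 : crossMatrix (s i • ![0, 0, 1]) - crossMatrix (s j • ![0, 0, 1]) =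
          (s i - s j) • crossE3 := by
        ext a b
        fin_cases a <;> fin_cases b <;> simp [crossMatrix, crossE3]
        ring
      rw [hblock, h1]
      simp only [Matrix.mul_smul, Matrix.smul_mul]
    · exact (isCameraCenter_cameraMatrix_iff (hV i) _ _).mpr rfl
    · refine (collinear_iff_exists_forall_eq_smul_vadd _).mpr ⟨0, ![0, 0, 1], ?_⟩
      rintro _ ⟨i, rfl⟩
      exact ⟨-s i, by simp⟩

namespace IsAxisForm

variable {n : ℕ} {F : Matrix (Fin n × Fin 3) (Fin n × Fin 3) ℝ}
  {V : Fin n → Matrix (Fin 3) (Fin 3) ℝ} {s : Fin n → ℝ}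

theorem apply_eq (h : IsAxisForm F V s) (x y : Fin n × Fin 3) :
    F x y = (s x.1 - s y.1) * (V x.1 x.2 1 * V y.1 y.2 0 - V x.1 x.2 0 * V y.1 y.2 1) := by
  have := congrFun (congrFun (h.block_eq x.1 y.1) x.2) y.2
  simp only [blockAt, submatrix_apply, Prod.mk.eta] at this
  rw [this]
  simp [crossE3, Matrix.mul_apply, Fin.sum_univ_three]
  left
  ring

/-- The quadratic form of `F` is hyperbolic: a combination of two products of linear forms. -/
theorem quadratic_eq (h : IsAxisForm F V s) (x : Fin n × Fin 3 → ℝ) :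
    x ⬝ᵥ F *ᵥ x =
      2 * ((fun z => s z.1 * V z.1 z.2 1) ⬝ᵥ x) * ((fun z => V z.1 z.2 0) ⬝ᵥ x) -
      2 * ((fun z => s z.1 * V z.1 z.2 0) ⬝ᵥ x) * ((fun z => V z.1 z.2 1) ⬝ᵥ x) := by
  have hF : F = vecMulVec (fun z => s z.1 * V z.1 z.2 1) (fun z => V z.1 z.2 0)
      - vecMulVec (fun z => s z.1 * V z.1 z.2 0) (fun z => V z.1 z.2 1)
      - vecMulVec (fun z => V z.1 z.2 1) (fun z => s z.1 * V z.1 z.2 0)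
      + vecMulVec (fun z => V z.1 z.2 0) (fun z => s z.1 * V z.1 z.2 1) := by
    ext y z
    rw [h.apply_eq]
    simp only [Matrix.add_apply, Matrix.sub_apply, vecMulVec_apply]
    ring
  conv_lhs => rw [hF]
  simp only [add_mulVec, sub_mulVec, dotProduct_add, dotProduct_sub, vecMulVec_mulVec,
    op_smul_eq_smul, dotProduct_smul, smul_eq_mul]
  rw [dotProduct_comm x, dotProduct_comm x, dotProduct_comm x, dotProduct_comm x]
  ring

/-- At most two eigenvalues have the sign of `σ`. The two linear forms are chosen so that the
quadratic form becomes `-2σ` times a sum of two squares on their common kernel. -/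
theorem card_eigenvalues_sign_le (h : IsAxisForm F V s) (hF : F.IsHermitian) (σ : ℝ) :
    Fintype.card {i // 0 < σ * hF.eigenvalues i} ≤ 2 := by
  refine card_eigenvalues_le_of_nonpos_on_ker hF (k := 2) (mulVecLin (of
    ![fun z => s z.1 * V z.1 z.2 1 + σ * V z.1 z.2 0,
      fun z => s z.1 * V z.1 z.2 0 - σ * V z.1 z.2 1])) σ fun x hx => ?_
  have e0 := congrFun hx 0
  have e1 := congrFun hx 1
  have a0 : (fun z : Fin n × Fin 3 => s z.1 * V z.1 z.2 1) ⬝ᵥ x =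
      -(σ * ((fun z => V z.1 z.2 0) ⬝ᵥ x)) := by
    rw [← sub_eq_zero, ← smul_eq_mul, ← smul_dotProduct, sub_neg_eq_add, ← add_dotProduct]
    exact e0
  have a1 : (fun z : Fin n × Fin 3 => s z.1 * V z.1 z.2 0) ⬝ᵥ x =
      σ * ((fun z => V z.1 z.2 1) ⬝ᵥ x) := by
    rw [← sub_eq_zero, ← smul_eq_mul, ← smul_dotProduct, ← sub_dotProduct]
    exact e1
  rw [h.quadratic_eq, a0, a1]
  nlinarith [sq_nonneg (σ * ((fun z : Fin n × Fin 3 => V z.1 z.2 0) ⬝ᵥ x)),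
    sq_nonneg (σ * ((fun z : Fin n × Fin 3 => V z.1 z.2 1) ⬝ᵥ x))]

theorem inv_mul_blockAt (h : IsAxisForm F V s) (i j : Fin n) :
    (V i)⁻¹ * blockAt F i j = (s i - s j) • (crossE3 * (V j)ᵀ) := by
  rw [h.block_eq, Matrix.mul_smul, Matrix.mul_assoc, ← Matrix.mul_assoc (V i)⁻¹,
    nonsing_inv_mul _ (h.isUnit_det i), Matrix.one_mul]

theorem four_le_rank (h : IsAxisForm F V s) {i j : Fin n} (hij : s i ≠ s j) : 4 ≤ F.rank := by
  set G := viewDiagonal (fun i => (V i)⁻¹) * F * (viewDiagonal (fun i => (V i)⁻¹))ᵀ with hG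
  have hblock : ∀ i j, blockAt G i j = (s i - s j) • crossE3 := fun i j => by
    rw [hG, blockAt_viewDiagonal_conj, h.inv_mul_blockAt, Matrix.smul_mul, Matrix.mul_assoc,
      ← transpose_mul, nonsing_inv_mul _ (h.isUnit_det j), transpose_one, Matrix.mul_one]
  have happ : ∀ i j a b, G (i, a) (j, b) = (s i - s j) * crossE3 a b := fun i j a b =>
    congrFun (congrFun (hblock i j) a) b
  let r : Fin 4 → Fin n × Fin 3 := ![(i, 0), (i, 1), (j, 0), (j, 1)]
  have hd : (G.submatrix r r).det ≠ 0 := by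
    have : G.submatrix r r = (s i - s j) • !![0, 0, 0, -1; 0, 0, 1, 0; 0, 1, 0, 0; -1, 0, 0, 0] := by
      ext a b
      fin_cases a <;> fin_cases b <;> simp [r, happ, crossE3]
    rw [this, det_smul]
    refine mul_ne_zero (pow_ne_zero _ (sub_ne_zero.mpr hij)) ?_
    simp [det_succ_row_zero, Fin.sum_univ_succ, Fin.succAbove]
  calc 4 = (G.submatrix r r).rank := by rw [rank_of_det_ne_zero hd, Fintype.card_fin]
    _ ≤ G.rank := rank_submatrix_le _ _ _
    _ ≤ F.rank := rank_viewDiagonal_conj_le _ _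

theorem param_ne (h : IsAxisForm F V s) (hF : IsNViewFundamental F) {i j : Fin n} (hij : i ≠ j) :
    s i ≠ s j := fun he => by
  have := hF.rank_offDiag i j hij
  rw [h.block_eq, he, sub_self, zero_smul, rank_zero] at this
  omega

theorem rank_blockRow (h : IsAxisForm F V s) (hF : IsNViewFundamental F) {i j : Fin n}
    (hij : i ≠ j) : (blockRow F i).rank = 2 := by
  apply le_antisymm
  · refine Nat.le_of_lt_succ (rank_lt_of_vecMul_eq_zero (blockRow F i) (v := (V i)⁻¹ 2) ?_ ?_)
    · intro h0
      have h1 := congrFun (congrFun (nonsing_inv_mul _ (h.isUnit_det i)) 2) 2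
      rw [Matrix.mul_apply] at h1
      simp [h0] at h1
    · ext ⟨k, b⟩
      have h1 := congrFun (congrFun (h.inv_mul_blockAt i k) 2) b
      refine h1.trans ?_
      simp [crossE3, vecMul, dotProduct, Fin.sum_univ_three]
  · rw [← hF.rank_offDiag i j hij]
    exact rank_submatrix_le (blockRow F i) id (fun b => (j, b))

theorem rank_and_signature (h : IsAxisForm F V s) (hF : F.IsSymm) {i j : Fin n}
    (hij : s i ≠ s j) :
    F.rank = 4 ∧ numPosEigenvalues F = 2 ∧ numNegEigenvalues F = 2 := by
  have hH : F.IsHermitian := by rwa [IsHermitian, conjTranspose_eq_transpose_of_trivial]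
  have hp := h.card_eigenvalues_sign_le hH 1
  have hm := h.card_eigenvalues_sign_le hH (-1)
  simp only [one_mul, neg_one_mul, neg_pos] at hp hm
  have hr := IsHermitian.rank_eq_card_pos_add_card_neg hH
  have h4 := h.four_le_rank hij
  rw [numPosEigenvalues, numNegEigenvalues, countP_roots_charpoly_eq_card hH,
    countP_roots_charpoly_eq_card hH]
  omega

end IsAxisForm

/-! ### Systems of planar blocks of rank four -/

/-- The standard symplectic `2 × 2` matrix, the nonzero part of `crossE3`. -/
def symplectic2 : Matrix (Fin 2) (Fin 2) ℝ := !![0, -1; 1, 0]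

theorem symplectic2_transpose : symplectic2ᵀ = -symplectic2 := by
  ext a b
  fin_cases a <;> fin_cases b <;> simp [symplectic2]

theorem symplectic2_mul_self : symplectic2 * symplectic2 = -1 := by
  ext a b
  fin_cases a <;> fin_cases b <;> simp [symplectic2]

theorem exists_eq_smul_symplectic2 {Z : Matrix (Fin 2) (Fin 2) ℝ} (h : Z + Zᵀ = 0) :
    ∃ z : ℝ, Z = z • symplectic2 := by
  have h' : ∀ a b, Z a b + Z b a = 0 := fun a b => congrFun (congrFun h a) b
  refine ⟨Z 1 0, ?_⟩
  ext a b
  fin_cases a <;> fin_cases b <;> simp [symplectic2]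
  · linarith [h' 0 0]
  · linarith [h' 0 1]
  · linarith [h' 1 1]

/-- If `X` is invertible and `XYᵀ` is skew, then `Y` is a multiple of `X` times the symplectic matrix,
because `X⁻¹Y` is skew as well. This says that the isotropic plane spanned by the rows of
`[X, Y]` belongs to one particular ruling of the quadric. -/
theorem exists_eq_smul_mul_symplectic2 {X Y : Matrix (Fin 2) (Fin 2) ℝ} (hX : IsUnit X.det)
    (h : X * Yᵀ + Y * Xᵀ = 0) : ∃ y : ℝ, Y = y • (X * symplectic2) := by
  obtain ⟨y, hy⟩ := exists_eq_smul_symplectic2 (Z := X⁻¹ * Y) (by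
    have hXt : Xᵀ * X⁻¹ᵀ = 1 := by rw [← transpose_mul, nonsing_inv_mul _ hX, transpose_one]
    calc X⁻¹ * Y + (X⁻¹ * Y)ᵀ
        = X⁻¹ * Y * (Xᵀ * X⁻¹ᵀ) + (X⁻¹ * X) * (Yᵀ * X⁻¹ᵀ) := by
          rw [hXt, nonsing_inv_mul _ hX, Matrix.mul_one, Matrix.one_mul, transpose_mul]
      _ = X⁻¹ * (X * Yᵀ + Y * Xᵀ) * X⁻¹ᵀ := by noncomm_ring
      _ = 0 := by rw [h, Matrix.mul_zero, Matrix.zero_mul])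
  exact ⟨y, by rw [← Matrix.mul_smul, ← hy, ← Matrix.mul_assoc, mul_nonsing_inv _ hX,
    Matrix.one_mul]⟩

/-- A translation of the homogeneous coordinate `(x : y)` keeps finitely many points away from
`x = 0`. -/
theorem exists_forall_add_mul_ne_zero {ι : Type*} [Finite ι] (x y : ι → ℝ)
    (h : ∀ i, x i ≠ 0 ∨ y i ≠ 0) : ∃ m : ℝ, ∀ i, x i + m * y i ≠ 0 := by
  have hfin : (⋃ i, {m : ℝ | x i + m * y i = 0}).Finite := by
    refine Set.finite_iUnion fun i => Set.Subsingleton.finite fun m hm m' hm' => ?_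
    simp only [Set.mem_ofPred_eq] at hm hm'
    have hy : y i ≠ 0 := fun hy => by
      rcases h i with h | h
      · exact h (by simpa [hy] using hm)
      · exact h hy
    exact mul_right_cancel₀ hy (by linarith)
  obtain ⟨m, hm⟩ := hfin.exists_notMem
  exact ⟨m, by simpa using hm⟩

/-- A symmetric system of `2 × 2` blocks, zero on the diagonal and invertible off it, that is
determined by two of its block columns as in rank four, is a system of multiples `s i - s j` of the
symplectic matrix up to congruence. -/
theorem exists_planar_form {ι : Type*} [Finite ι] {g : ι → ι → Matrix (Fin 2) (Fin 2) ℝ}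
    (hsymm : ∀ i j, (g i j)ᵀ = g j i) (hdiag : ∀ i, g i i = 0)
    (hdet : ∀ i j, i ≠ j → IsUnit (g i j).det) {a b : ι} (hab : a ≠ b)
    (hform : ∀ i j, g i j = g i a * (g b a)⁻¹ * g b j + g i b * (g a b)⁻¹ * g a j) :
    ∃ (C : ι → Matrix (Fin 2) (Fin 2) ℝ) (s : ι → ℝ), (∀ i, IsUnit (C i).det) ∧
      ∀ i j, g i j = (s i - s j) • (C i * symplectic2 * (C j)ᵀ) := by
  set X : ι → Matrix (Fin 2) (Fin 2) ℝ := fun i => g i a * (g b a)⁻¹ with hX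
  set Y : ι → Matrix (Fin 2) (Fin 2) ℝ := fun i => g i b with hY
  have hXY : ∀ i j, g i j = X i * (Y j)ᵀ + Y i * (X j)ᵀ := fun i j => by
    rw [hform i j]
    simp only [hX, hY, transpose_mul, transpose_nonsing_inv, hsymm, Matrix.mul_assoc]
  have hXdet : ∀ i, i ≠ a → IsUnit (X i).det := fun i hi => by
    simp only [hX, det_mul]
    exact (hdet i a hi).mul (isUnit_nonsing_inv_det _ (hdet b a hab.symm))
  have hpar : ∀ i, ∃ (C : Matrix (Fin 2) (Fin 2) ℝ) (x y : ℝ), IsUnit C.det ∧ X i = x • C ∧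
      Y i = y • (C * symplectic2) ∧ (x ≠ 0 ∨ y ≠ 0) := fun i => by
    by_cases hi : i = a
    -- Here `X a = 0`, and `C` is chosen so that `Y a = C * symplectic2`.
    · subst hi
      refine ⟨-(Y i * symplectic2), 0, 1, ?_, ?_, ?_, Or.inr one_ne_zero⟩
      · rw [det_neg, det_mul]
        refine IsUnit.mul (by simp) ((hdet i b hab).mul ?_)
        simp [symplectic2, det_fin_two]
      · simp [hX, hdiag]
      · rw [one_smul, Matrix.neg_mul, Matrix.mul_assoc, symplectic2_mul_self]
        simp
    · obtain ⟨y, hy⟩ := exists_eq_smul_mul_symplectic2 (hXdet i hi)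
        (by rw [← hXY, hdiag] : X i * (Y i)ᵀ + Y i * (X i)ᵀ = 0)
      exact ⟨X i, 1, y, hXdet i hi, (one_smul _ _).symm, hy, Or.inl one_ne_zero⟩
  choose C x y hC hx hy hne using hpar
  obtain ⟨m, hm⟩ := exists_forall_add_mul_ne_zero x y hne
  refine ⟨fun i => (x i + m * y i) • C i, fun i => y i / (x i + m * y i), fun i => ?_,
    fun i j => ?_⟩
  · rw [det_smul]
    exact (((hm i).isUnit).pow _).mul (hC i)
  · have h1 : g i j = (y i * x j - x i * y j) • (C i * symplectic2 * (C j)ᵀ) := by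
      rw [hXY, hx, hx, hy, hy]
      simp only [transpose_smul, transpose_mul, symplectic2_transpose, Matrix.smul_mul,
        Matrix.mul_smul, Matrix.neg_mul, Matrix.mul_neg, smul_smul, sub_smul, Matrix.mul_assoc]
      module
    rw [h1]
    simp only [transpose_smul, Matrix.smul_mul, Matrix.mul_smul, smul_smul]
    congr 1
    linear_combination -(x j + m * y j) * div_mul_cancel₀ (y i) (hm i) +
      (x i + m * y i) * div_mul_cancel₀ (y j) (hm j)

/-! ### Reduction to planar blocks -/

theorem exists_isUnit_det_row_eq {v : Fin 3 → ℝ} (hv : v ≠ 0) :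
    ∃ N : Matrix (Fin 3) (Fin 3) ℝ, IsUnit N.det ∧ N 2 = v := by
  obtain ⟨k, hk⟩ := Function.ne_iff.mp hv
  fin_cases k
  · exact ⟨of ![![0, 1, 0], ![0, 0, 1], v], by simpa [det_fin_three] using hk, rfl⟩
  · exact ⟨of ![![1, 0, 0], ![0, 0, 1], v], by simpa [det_fin_three] using hk, rfl⟩
  · exact ⟨of ![![1, 0, 0], ![0, 1, 0], v], by simpa [det_fin_three] using hk, rfl⟩

/-- The inclusion of the coordinate plane into space, as a `3 × 2` matrix. -/
def planeIncl : Matrix (Fin 3) (Fin 2) ℝ := !![1, 0; 0, 1; 0, 0]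

/-- The extension of a planar matrix to space by the identity on the third axis. -/
def extendPlanar (C : Matrix (Fin 2) (Fin 2) ℝ) : Matrix (Fin 3) (Fin 3) ℝ :=
  !![C 0 0, C 0 1, 0; C 1 0, C 1 1, 0; 0, 0, 1]

theorem det_extendPlanar (C : Matrix (Fin 2) (Fin 2) ℝ) : (extendPlanar C).det = C.det := by
  simp [extendPlanar, det_fin_three, det_fin_two]

theorem extendPlanar_conj_crossE3 (C C' : Matrix (Fin 2) (Fin 2) ℝ) :
    extendPlanar C * crossE3 * (extendPlanar C')ᵀ =
      planeIncl * (C * symplectic2 * C'ᵀ) * planeInclᵀ := by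
  ext a b
  fin_cases a <;> fin_cases b <;>
    simp [extendPlanar, crossE3, planeIncl, symplectic2, vecMul, dotProduct, Matrix.mul_apply,
      Fin.sum_univ_three]

theorem eq_planeIncl_conj {M : Matrix (Fin 3) (Fin 3) ℝ} (hrow : ∀ b, M 2 b = 0)
    (hcol : ∀ a, M a 2 = 0) :
    M = planeIncl * M.submatrix Fin.castSucc Fin.castSucc * planeInclᵀ := by
  ext a b
  fin_cases a <;> fin_cases b <;> simp [planeIncl, vecMul, dotProduct, Matrix.mul_apply, hrow, hcol]

theorem isUnit_det_of_rank_planeIncl_conj {g : Matrix (Fin 2) (Fin 2) ℝ}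
    (h : (planeIncl * g * planeInclᵀ).rank = 2) : IsUnit g.det := by
  by_contra hd
  rw [isUnit_iff_ne_zero, not_not, ← exists_vecMul_eq_zero_iff] at hd
  obtain ⟨v, hv, hv0⟩ := hd
  have h1 := rank_lt_of_vecMul_eq_zero g hv hv0
  have h2 := (rank_mul_le_left (planeIncl * g) planeInclᵀ).trans (rank_mul_le_right planeIncl g)
  rw [h] at h2
  simp at h1
  omega

/-- The Schur complement formula of `apply_eq_of_rank_le` for the minor formed by the first two
coordinates of two views. -/
theorem planar_block_eq_of_rank_le {n : ℕ} {G : Matrix (Fin n × Fin 3) (Fin n × Fin 3) ℝ}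
    (hrank : G.rank ≤ 4) {g : Fin n → Fin n → Matrix (Fin 2) (Fin 2) ℝ}
    (hg : ∀ i j, g i j = (blockAt G i j).submatrix Fin.castSucc Fin.castSucc)
    (hdiag : ∀ i, g i i = 0) {a b : Fin n}
    (hdab : IsUnit (g a b).det) (hdba : IsUnit (g b a).det) (i j : Fin n) :
    g i j = g i a * (g b a)⁻¹ * g b j + g i b * (g a b)⁻¹ * g a j := by
  let r : Fin 2 ⊕ Fin 2 → Fin n × Fin 3 :=
    Sum.elim (fun u => (a, u.castSucc)) (fun u => (b, u.castSucc))
  have hsub : G.submatrix r r = fromBlocks 0 (g a b) (g b a) 0 := by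
    rw [← hdiag a]
    nth_rw 2 [hdiag a]
    rw [← hdiag b]
    ext (u | u) (v | v) <;> simp [r, hg, blockAt]
  have hinv : G.submatrix r r * fromBlocks 0 (g b a)⁻¹ (g a b)⁻¹ 0 = 1 := by
    rw [hsub, fromBlocks_multiply]
    simp [mul_nonsing_inv _ hdab, mul_nonsing_inv _ hdba]
  ext u v
  have h1 := apply_eq_of_rank_le G r r (by simpa using hrank)
    (isUnit_det_of_right_inverse hinv) (i, u.castSucc) (j, v.castSucc)
  rw [inv_eq_right_inv hinv] at h1
  have happ : ∀ i j u v, g i j u v = G (i, u.castSucc) (j, v.castSucc) := fun i j u v => by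
    rw [hg]; rfl
  rw [happ, h1, dotProduct_mulVec, Matrix.add_apply]
  simp [dotProduct, vecMul, Matrix.mul_apply, happ, r, Fin.sum_univ_two]
  ring

theorem exists_isAxisForm_of_rank {n : ℕ} {F : Matrix (Fin n × Fin 3) (Fin n × Fin 3) ℝ}
    (hF : IsNViewFundamental F) {a b : Fin n} (hab : a ≠ b) (hrank : F.rank ≤ 4)
    (hrow : ∀ i, (blockRow F i).rank = 2) : ∃ V s, IsAxisForm F V s := by
  have hN : ∀ i, ∃ N : Matrix (Fin 3) (Fin 3) ℝ, IsUnit N.det ∧ N 2 ᵥ* blockRow F i = 0 :=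
    fun i => by
      obtain ⟨v, hv, hv0⟩ := exists_vecMul_eq_zero_of_rank_lt (blockRow F i) (by simp [hrow i])
      obtain ⟨N, hN, hNv⟩ := exists_isUnit_det_row_eq hv
      exact ⟨N, hN, by rw [hNv, hv0]⟩
  choose N hNdet hN0 using hN
  set G := viewDiagonal N * F * (viewDiagonal N)ᵀ with hG
  have hGrank : G.rank ≤ 4 := (rank_viewDiagonal_conj_le N F).trans hrank
  have hblock : ∀ i j, blockAt G i j = N i * blockAt F i j * (N j)ᵀ :=
    blockAt_viewDiagonal_conj N F
  have hGsymm : ∀ i j, (blockAt G i j)ᵀ = blockAt G j i := fun i j => by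
    rw [hblock, hblock, transpose_mul, transpose_mul, transpose_transpose,
      blockAt_transpose hF.symm, Matrix.mul_assoc]
  have hGrow : ∀ i j c, blockAt G i j 2 c = 0 := fun i j c => by
    have h1 : ∀ d, (N i * blockAt F i j) 2 d = 0 := fun d => congrFun (hN0 i) (j, d)
    rw [hblock, Matrix.mul_apply]
    simp [h1]
  have hGcol : ∀ i j c, blockAt G i j c 2 = 0 := fun i j c => by
    rw [← hGsymm j i]
    exact hGrow j i c
  set g : Fin n → Fin n → Matrix (Fin 2) (Fin 2) ℝ :=
    fun i j => (blockAt G i j).submatrix Fin.castSucc Fin.castSucc with hg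
  have hGg : ∀ i j, blockAt G i j = planeIncl * g i j * planeInclᵀ := fun i j =>
    eq_planeIncl_conj (hGrow i j) (hGcol i j)
  have hgdiag : ∀ i, g i i = 0 := fun i => by simp [hg, hblock, hF.diag]
  have hgdet : ∀ i j, i ≠ j → IsUnit (g i j).det := fun i j hij => by
    apply isUnit_det_of_rank_planeIncl_conj
    rw [← hGg, hblock, rank_mul_eq_left_of_isUnit_det _ _ (by rw [det_transpose]; exact hNdet j),
      rank_mul_eq_right_of_isUnit_det _ _ (hNdet i), hF.rank_offDiag i j hij]
  obtain ⟨C, s, hC, hCs⟩ := exists_planar_form (g := g)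
    (fun i j => by rw [hg]; simp only [transpose_submatrix, hGsymm]) hgdiag hgdet hab
    (planar_block_eq_of_rank_le hGrank (fun _ _ => rfl) hgdiag (hgdet a b hab)
      (hgdet b a hab.symm))
  refine ⟨fun i => (N i)⁻¹ * extendPlanar (C i), s, fun i => ?_, fun i j => ?_⟩
  · rw [det_mul, det_extendPlanar]
    exact (isUnit_nonsing_inv_det _ (hNdet i)).mul (hC i)
  · have h1 : blockAt F i j = (N i)⁻¹ * blockAt G i j * ((N j)⁻¹)ᵀ := by
      have h2 : (N j)ᵀ * ((N j)⁻¹)ᵀ = 1 := by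
        rw [← transpose_mul, nonsing_inv_mul _ (hNdet j), transpose_one]
      calc blockAt F i j = ((N i)⁻¹ * N i) * blockAt F i j * ((N j)ᵀ * ((N j)⁻¹)ᵀ) := by
            rw [h2, nonsing_inv_mul _ (hNdet i), Matrix.one_mul, Matrix.mul_one]
        _ = _ := by rw [hblock]; simp only [Matrix.mul_assoc]
    have h3 : blockAt G i j =
        (s i - s j) • (extendPlanar (C i) * crossE3 * (extendPlanar (C j))ᵀ) := by
      rw [extendPlanar_conj_crossE3, hGg, hCs, Matrix.mul_smul, Matrix.smul_mul]
    rw [h1, h3, transpose_mul]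
    simp only [Matrix.mul_smul, Matrix.smul_mul, Matrix.mul_assoc]

theorem theorem2 (n : ℕ) (hn : 2 ≤ n) (F : Matrix (Fin n × Fin 3) (Fin n × Fin 3) ℝ)
    (hF : IsNViewFundamental F) :
    (IsConsistent F ∧
        ∃ P : Fin n → Matrix (Fin 3) (Fin 3 ⊕ Fin 1) ℝ,
          IsRealizedBy F P ∧ HaveCollinearCenters P) ↔
      ((F.rank = 4 ∧ numPosEigenvalues F = 2 ∧ numNegEigenvalues F = 2) ∧
        ∀ i : Fin n, (blockRow F i).rank = 2) := by
  have : Nontrivial (Fin n) := Fin.nontrivial_iff_two_le.mpr hn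
  constructor
  · rintro ⟨-, h⟩
    obtain ⟨V, s, h⟩ := (exists_realization_collinear_iff F).mp h
    refine ⟨?_, fun i => ?_⟩
    · obtain ⟨i, j, hij⟩ := exists_pair_ne (Fin n)
      exact h.rank_and_signature hF.symm (h.param_ne hF hij)
    · obtain ⟨j, hj⟩ := exists_ne i
      exact h.rank_blockRow hF hj.symm
  · rintro ⟨⟨hrank, -⟩, hrow⟩
    obtain ⟨i, j, hij⟩ := exists_pair_ne (Fin n)
    obtain ⟨P, hP, hcol⟩ := (exists_realization_collinear_iff F).mpr
      (exists_isAxisForm_of_rank hF hij hrank.le hrow)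
    exact ⟨⟨P, hP⟩, P, hP, hcol⟩
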